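/- For matrices $b\in M_3(\mathbb C)$ let $\|b\|$ be the operator norm and $\|b\|_1=\operatorname{Tr}(b^*b)^{1/2}$ the trace norm. On $M_3(\mathbb C)\otimes M_3(\mathbb C)$ let $$\pi(x)=\inf\Big\{\sum_i\|a_i\|\,\|b_i\|_1 : x=\sum_i a_i\otimes b_i\ \text{(finite sum)}\Big\},\qquad \alpha(\rho)=\sup_{a\ne 0}\frac{|\operatorname{Tr}(\rho a)|}{\pi(a)}$$ be the projective norm and its dual norm with respect to the trace pairing. Let $$\mathfrak D=\big\{\rho\in M_3(\mathbb C)\otimes M_3(\mathbb C) : \rho=\rho^*,\ \alpha(\rho)=1,\ (x\otimes y,\rho\, x\otimes y)\ge 0\ \text{for all } x,y\in\mathbb C^3,\ \operatorname{Tr}\rho=3\big\}$$ (the set of Choi matrices $\sum_{ij}E_{ij}\otimes\phi(E_{ij})$ of the normalized unital positive maps $\phi$ of $M_3(\mathbb C)$). A point $\rho\in\mathfrak D$ is an exposed point of $\mathfrak D$ if there is a real-linear functional $\omega$ with $\omega(\sigma)<\omega(\rho)$ for every $\sigma\in\mathfrak D$, $\sigma\neq\rho$. Then: (i) every symmetry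 $s\in\mathfrak D$, i.e. every $s\in\mathfrak D$ with $s=s^*$ and $s^2=1$, is an exposed point of $\mathfrak D$; (ii) for every maximally entangled vector $x\in\mathbb C^3\otimes\mathbb C^3$, i.e. $x=\frac1{\sqrt3}\sum_{k=1}^3 f_k\otimes g_k$ with orthonormal bases $(f_k)$, $(g_k)$ of $\mathbb C^3$, the matrix $3P_x$ belongs to $\mathfrak D$ and is an exposed point of $\mathfrak D$, where $P_x$ is the orthogonal projector onto $\mathbb C x$. -/

import Mathlib

open scoped Kronecker ComplexOrder MatrixOrder Matrix

/-- The matrix algebra `M_n(ℂ)`. -/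
abbrev Mat (n : ℕ) : Type := Matrix (Fin n) (Fin n) ℂ

/-- The algebra `M_n(ℂ) ⊗ M_n(ℂ)`, realised by matrices indexed by pairs; the elementary tensor
`a ⊗ b` is the Kronecker product `a ⊗ₖ b`. -/
abbrev Mat2 (n : ℕ) : Type := Matrix (Fin n × Fin n) (Fin n × Fin n) ℂ

/-- Operator norm of a matrix acting on the Hilbert space `ℂⁿ`. -/
noncomputable def opNorm {n : ℕ} (a : Mat n) : ℝ :=
  ‖Matrix.toEuclideanCLM (n := Fin n) (𝕜 := ℂ) a‖

/-- Trace norm `‖b‖₁ = Tr (b* b)^{1/2}` (the trace is a nonnegative real number). -/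
noncomputable def traceNorm {n : ℕ} (b : Mat n) : ℝ :=
  (Matrix.trace (CFC.sqrt (bᴴ * b))).re

/-- Projective norm on `M_n ⊗ M_n`, with the operator norm on the first factor and the trace norm
on the second one. -/
noncomputable def projNorm {n : ℕ} (x : Mat2 n) : ℝ :=
  sInf {r : ℝ | ∃ (k : ℕ) (a b : Fin k → Mat n),
    x = ∑ i, a i ⊗ₖ b i ∧ r = ∑ i, opNorm (a i) * traceNorm (b i)}

/-- The norm `α`, dual to the projective norm with respect to the trace pairing. -/
noncomputable def alphaNorm {n : ℕ} (ρ : Mat2 n) : ℝ :=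
  sSup {r : ℝ | ∃ a : Mat2 n, a ≠ 0 ∧ r = ‖Matrix.trace (ρ * a)‖ / projNorm a}

/-- The product vector `x ⊗ y` in `ℂⁿ ⊗ ℂⁿ`. -/
def tensorVec {n : ℕ} (x y : Fin n → ℂ) : Fin n × Fin n → ℂ := fun p => x p.1 * y p.2

/-- Block positivity: `(x ⊗ y, ρ (x ⊗ y)) ≥ 0` for all `x`, `y`. -/
def IsBlockPositive {n : ℕ} (ρ : Mat2 n) : Prop :=
  ∀ x y : Fin n → ℂ, 0 ≤ star (tensorVec x y) ⬝ᵥ (ρ *ᵥ tensorVec x y)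

/-- The set `𝔇` of Choi matrices of normalized unital positive maps of `M_n(ℂ)`. -/
def choiSet (n : ℕ) : Set (Mat2 n) :=
  {ρ | ρ.IsHermitian ∧ alphaNorm ρ = 1 ∧ IsBlockPositive ρ ∧ Matrix.trace ρ = n}

/-- A symmetry is a selfadjoint unitary. -/
def IsSymmetry {n : ℕ} (s : Mat2 n) : Prop := s.IsHermitian ∧ s * s = 1

/-- A vector of `ℂⁿ ⊗ ℂⁿ` is maximally entangled if it equals `n^{-1/2} ∑ₖ fₖ ⊗ gₖ` for some
orthonormal bases `f`, `g` of `ℂⁿ`. -/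
def IsMaximallyEntangled {n : ℕ} (x : Fin n × Fin n → ℂ) : Prop :=
  ∃ f g : OrthonormalBasis (Fin n) ℂ (EuclideanSpace ℂ (Fin n)),
    x = ((1 / Real.sqrt n : ℝ) : ℂ) • ∑ k, tensorVec (fun i => f k i) (fun j => g k j)

/-- The rank one operator `|x⟩⟨x|`; for a unit vector `x` it is the orthogonal projector `P_x`
onto the line spanned by `x`. -/
def ketBra {n : ℕ} (x : Fin n × Fin n → ℂ) : Mat2 n := Matrix.vecMulVec x (star x)

/-! The Hilbert–Schmidt ball is strictly convex, and `choiSet n` lies in the one given by `Tr σ² ≤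
n²`. A member `ρ` with `Tr ρ² = n²` is therefore exposed by `σ ↦ Re Tr (ρ σ)`. For `n = 3`,
symmetries and the matrices `3 P_x` both have `Tr ρ² = 9`.

The bound (`trace_mul_self_re_le_of_mem_choiSet`) comes from the blocks `A i k = φ(E i k)`. Testing
`α` on `1 ⊗ |y⟩⟨y|` gives `∑ A i i ≤ 1`. Block positivity at `(e_i + c e_k) ⊗ y` dominates the
off-diagonal blocks by the diagonal ones, and the resulting trace inequalities sum to `n²`.

That `3 P_x` is a member (`ketBra_mem_choiSet_of_unitary`) follows by reshaping `√3 x` into a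
unitary `u`: the associated map `a ↦ (u* a u)ᵀ` contracts the operator norm, so `α ≤ 1` by trace
duality, with equality at the identity. -/

/-! ### Operator norm, trace norm and their duality -/

theorem opNorm_nonneg {n : ℕ} (a : Mat n) : 0 ≤ opNorm a := norm_nonneg _

theorem norm_mulVec_le_opNorm {n : ℕ} (a : Mat n) (x : Fin n → ℂ) :
    ‖WithLp.toLp 2 (a *ᵥ x)‖ ≤ opNorm a * ‖WithLp.toLp 2 x‖ :=
  (Matrix.toEuclideanCLM (n := Fin n) (𝕜 := ℂ) a).le_opNorm (WithLp.toLp 2 x)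

theorem star_dotProduct_self_eq_norm_sq {n : ℕ} (x : Fin n → ℂ) :
    star x ⬝ᵥ x = ((‖WithLp.toLp 2 x‖ ^ 2 : ℝ) : ℂ) := by
  rw [EuclideanSpace.norm_sq_eq, dotProduct]
  push_cast
  exact Finset.sum_congr rfl fun i _ => Complex.conj_mul' (x i)

theorem norm_dotProduct_le {n : ℕ} (x y : Fin n → ℂ) :
    ‖x ⬝ᵥ y‖ ≤ ‖WithLp.toLp 2 x‖ * ‖WithLp.toLp 2 y‖ := by
  have h := norm_inner_le_norm (𝕜 := ℂ) (WithLp.toLp 2 (star x)) (WithLp.toLp 2 y)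
  rw [EuclideanSpace.inner_toLp_toLp, star_star, dotProduct_comm] at h
  simpa [EuclideanSpace.norm_eq] using h

theorem opNorm_mul_le {n : ℕ} (a b : Mat n) : opNorm (a * b) ≤ opNorm a * opNorm b :=
  Matrix.l2_opNorm_mul a b

theorem opNorm_transpose_le {n : ℕ} (a : Mat n) : opNorm aᵀ ≤ opNorm a := by
  refine ContinuousLinearMap.opNorm_le_bound _ (opNorm_nonneg a) fun y => ?_
  set z : Fin n → ℂ := aᵀ *ᵥ y.ofLp with hz
  change ‖WithLp.toLp 2 z‖ ≤ opNorm a * ‖y‖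
  have h1 : z ⬝ᵥ star z = y.ofLp ⬝ᵥ (a *ᵥ star z) := by
    rw [Matrix.dotProduct_mulVec, ← Matrix.mulVec_transpose]
  have hs : ‖WithLp.toLp 2 (star z)‖ = ‖WithLp.toLp 2 z‖ := by simp [EuclideanSpace.norm_eq]
  have h2 : ‖WithLp.toLp 2 z‖ ^ 2 ≤ ‖y‖ * (opNorm a * ‖WithLp.toLp 2 z‖) := by
    calc ‖WithLp.toLp 2 z‖ ^ 2 = ‖z ⬝ᵥ star z‖ := by
          rw [dotProduct_comm, star_dotProduct_self_eq_norm_sq, Complex.norm_real, Real.norm_eq_abs,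
            abs_of_nonneg (by positivity)]
      _ ≤ ‖y‖ * ‖WithLp.toLp 2 (a *ᵥ star z)‖ := by rw [h1]; exact norm_dotProduct_le _ _
      _ ≤ _ := by
          gcongr
          rw [← hs]
          exact norm_mulVec_le_opNorm a (star z)
  rcases eq_or_ne ‖WithLp.toLp 2 z‖ 0 with h0 | h0
  · rw [h0]; exact mul_nonneg (opNorm_nonneg a) (norm_nonneg _)
  · have : 0 < ‖WithLp.toLp 2 z‖ := lt_of_le_of_ne (norm_nonneg _) h0.symm
    refine le_of_mul_le_mul_right ?_ this
    nlinarith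

theorem norm_mulVec_eq_of_conjTranspose_mul_self_eq {n : ℕ} {a b : Mat n}
    (h : aᴴ * a = bᴴ * b) (x : Fin n → ℂ) :
    ‖WithLp.toLp 2 (a *ᵥ x)‖ = ‖WithLp.toLp 2 (b *ᵥ x)‖ := by
  have key : ∀ c : Mat n, star (c *ᵥ x) ⬝ᵥ (c *ᵥ x) = star x ⬝ᵥ ((cᴴ * c) *ᵥ x) := fun c => by
    rw [Matrix.star_mulVec, ← Matrix.dotProduct_mulVec, Matrix.mulVec_mulVec]
  have h1 := key a
  rw [h, ← key b, star_dotProduct_self_eq_norm_sq, star_dotProduct_self_eq_norm_sq] at h1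
  exact (sq_eq_sq₀ (norm_nonneg _) (norm_nonneg _)).1 (by exact_mod_cast h1)

theorem posSemidef_sqrt_conjTranspose_mul_self {n : ℕ} (b : Mat n) :
    (CFC.sqrt (bᴴ * b)).PosSemidef :=
  Matrix.nonneg_iff_posSemidef.1 (CFC.sqrt_nonneg _)

theorem traceNorm_nonneg {n : ℕ} (b : Mat n) : 0 ≤ traceNorm b :=
  (Complex.nonneg_iff.1 (posSemidef_sqrt_conjTranspose_mul_self b).trace_nonneg).1

/-- Duality between the operator norm and the trace norm. -/
theorem norm_trace_mul_le {n : ℕ} (c b : Mat n) :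
    ‖Matrix.trace (c * b)‖ ≤ opNorm c * traceNorm b := by
  have hH := posSemidef_sqrt_conjTranspose_mul_self b
  set H := CFC.sqrt (bᴴ * b) with hHdef
  have hHH : bᴴ * b = Hᴴ * H := by
    rw [hH.1.eq]
    exact (CFC.sqrt_mul_sqrt_self _
      (Matrix.nonneg_iff_posSemidef.2 (Matrix.posSemidef_conjTranspose_mul_self b))).symm
  -- Expand the trace in an eigenbasis of `|b|`: there `‖b vᵢ‖` is the `i`-th eigenvalue, and these
  -- sum to the trace norm.
  set v := hH.1.eigenvectorBasis
  have htr : traceNorm b = ∑ i, hH.1.eigenvalues i := by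
    rw [traceNorm, ← hHdef, hH.1.trace_eq_sum_eigenvalues]
    simp
  have hbv : ∀ i, ‖WithLp.toLp 2 (b *ᵥ (v i).ofLp)‖ = hH.1.eigenvalues i := fun i => by
    rw [norm_mulVec_eq_of_conjTranspose_mul_self_eq hHH, hH.1.mulVec_eigenvectorBasis,
      WithLp.toLp_smul, WithLp.toLp_ofLp, norm_smul, v.norm_eq_one, mul_one, Real.norm_eq_abs,
      abs_of_nonneg (hH.eigenvalues_nonneg i)]
  have hsum : Matrix.trace (c * b) =
      ∑ i, inner ℂ (v i) (Matrix.toEuclideanLin (c * b) (v i)) := by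
    rw [← LinearMap.trace_eq_sum_inner, Matrix.toEuclideanLin_eq_toLin_orthonormal,
      Matrix.trace_toLin_eq]
  rw [hsum, htr, Finset.mul_sum]
  refine (norm_sum_le _ _).trans (Finset.sum_le_sum fun i _ => ?_)
  refine (norm_inner_le_norm _ _).trans ?_
  rw [v.norm_eq_one, one_mul, ← hbv i]
  have : Matrix.toEuclideanLin (c * b) (v i) = WithLp.toLp 2 (c *ᵥ (b *ᵥ (v i).ofLp)) := by
    rw [Matrix.mulVec_mulVec]; rfl
  rw [this]
  exact norm_mulVec_le_opNorm _ _

theorem traceNorm_eq_trace_of_posSemidef {n : ℕ} {b : Mat n} (hb : b.PosSemidef) :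
    traceNorm b = (Matrix.trace b).re := by
  rw [traceNorm, hb.1.eq, CFC.sqrt_mul_self b (Matrix.nonneg_iff_posSemidef.2 hb)]

theorem opNorm_one_le {n : ℕ} : opNorm (1 : Mat n) ≤ 1 := by
  rw [opNorm, map_one]
  exact ContinuousLinearMap.norm_id_le

theorem opNorm_le_one_of_conjTranspose_mul_self {n : ℕ} {u : Mat n} (hu : uᴴ * u = 1) :
    opNorm u ≤ 1 := by
  have h : opNorm (uᴴ * u) = opNorm u * opNorm u := Matrix.l2_opNorm_conjTranspose_mul_self u
  rw [hu] at h
  nlinarith [opNorm_one_le (n := n), opNorm_nonneg u]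

theorem opNorm_conjTranspose {n : ℕ} (a : Mat n) : opNorm aᴴ = opNorm a :=
  Matrix.l2_opNorm_conjTranspose a

/-! ### The projective norm and its pairing with rank one matrices -/

theorem exists_eq_sum_kronecker {n : ℕ} (x : Mat2 n) :
    ∃ (k : ℕ) (a b : Fin k → Mat n), x = ∑ i, a i ⊗ₖ b i := by
  let e := (Fintype.equivFin ((Fin n × Fin n) × (Fin n × Fin n))).symm
  refine ⟨_, fun i => Matrix.single (e i).1.1 (e i).2.1 (x (e i).1 (e i).2),
    fun i => Matrix.single (e i).1.2 (e i).2.2 1, ?_⟩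
  rw [e.sum_comp (fun p => Matrix.single p.1.1 p.2.1 (x p.1 p.2) ⊗ₖ Matrix.single p.1.2 p.2.2 1),
    Fintype.sum_prod_type]
  conv_lhs => rw [Matrix.matrix_eq_sum_single x]
  simp [Matrix.single_kronecker_single]

theorem projNorm_nonneg {n : ℕ} (x : Mat2 n) : 0 ≤ projNorm x := by
  refine Real.sInf_nonneg ?_
  rintro _ ⟨k, a, b, -, rfl⟩
  exact Finset.sum_nonneg fun i _ => mul_nonneg (opNorm_nonneg _) (traceNorm_nonneg _)

theorem projNorm_kronecker_le {n : ℕ} (a b : Mat n) :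
    projNorm (a ⊗ₖ b) ≤ opNorm a * traceNorm b := by
  refine csInf_le ⟨0, ?_⟩ ⟨1, fun _ => a, fun _ => b, by simp, by simp⟩
  rintro _ ⟨k, a, b, -, rfl⟩
  exact Finset.sum_nonneg fun i _ => mul_nonneg (opNorm_nonneg _) (traceNorm_nonneg _)

/-- Reshaping the vector into a matrix `u` turns the pairing on `M_n ⊗ M_n` into one on `M_n`, where
trace duality applies. -/
theorem trace_ketBra_mul_kronecker {n : ℕ} (u a b : Mat n) :
    Matrix.trace (ketBra (fun p => u p.1 p.2) * a ⊗ₖ b) = Matrix.trace ((uᴴ * a * u)ᵀ * b) := by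
  simp only [Matrix.trace, Matrix.diag_apply, Matrix.mul_apply, ketBra, Matrix.vecMulVec_apply,
    Matrix.kronecker_apply, Fintype.sum_prod_type, Matrix.transpose_apply, Pi.star_apply,
    Matrix.conjTranspose_apply, Finset.sum_mul]
  rw [Finset.sum_comm]
  refine Finset.sum_congr rfl fun j _ => ?_
  trans ∑ i, ∑ j', ∑ i', u i j * star (u i' j') * (a i' i * b j' j)
  · exact Finset.sum_congr rfl fun i _ => Finset.sum_comm
  rw [Finset.sum_comm]
  refine Finset.sum_congr rfl fun j' _ => Finset.sum_congr rfl fun i _ =>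
    Finset.sum_congr rfl fun i' _ => ?_
  ring

theorem norm_trace_ketBra_mul_le_projNorm {n : ℕ} {u : Mat n} (hu : uᴴ * u = 1) (x : Mat2 n) :
    ‖Matrix.trace (ketBra (fun p => u p.1 p.2) * x)‖ ≤ projNorm x := by
  refine le_csInf ?_ ?_
  · obtain ⟨k, a, b, h⟩ := exists_eq_sum_kronecker x
    exact ⟨_, k, a, b, h, rfl⟩
  · rintro _ ⟨k, a, b, rfl, rfl⟩
    rw [Finset.mul_sum, Matrix.trace_sum]
    refine (norm_sum_le _ _).trans (Finset.sum_le_sum fun i _ => ?_)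
    rw [trace_ketBra_mul_kronecker]
    refine (norm_trace_mul_le _ _).trans ?_
    refine mul_le_mul_of_nonneg_right ?_ (traceNorm_nonneg _)
    have h1 := opNorm_le_one_of_conjTranspose_mul_self hu
    have h2 := opNorm_nonneg (a i)
    calc opNorm (uᴴ * a i * u)ᵀ ≤ opNorm (uᴴ * a i * u) := opNorm_transpose_le _
      _ ≤ opNorm (uᴴ * a i) * opNorm u := opNorm_mul_le _ _
      _ ≤ opNorm (uᴴ * a i) * 1 := mul_le_mul_of_nonneg_left h1 (opNorm_nonneg _)
      _ ≤ opNorm uᴴ * opNorm (a i) := by rw [mul_one]; exact opNorm_mul_le _ _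
      _ ≤ 1 * opNorm (a i) := by
        rw [opNorm_conjTranspose]; exact mul_le_mul_of_nonneg_right h1 h2
      _ = opNorm (a i) := one_mul _

theorem norm_trace_mul_le_projNorm_of_alphaNorm_eq_one {n : ℕ} {ρ : Mat2 n} (h : alphaNorm ρ = 1)
    {a : Mat2 n} (ha : 0 < projNorm a) (ha0 : a ≠ 0) : ‖Matrix.trace (ρ * a)‖ ≤ projNorm a := by
  -- An unbounded set has `sSup` equal to `0` in `ℝ`, so the value `1` forces boundedness.
  have hbdd : BddAbove {r : ℝ | ∃ a : Mat2 n, a ≠ 0 ∧ r = ‖Matrix.trace (ρ * a)‖ / projNorm a} := by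
    by_contra hb
    rw [alphaNorm, Real.sSup_of_not_bddAbove hb] at h
    exact zero_ne_one h
  have h1 := le_csSup hbdd ⟨a, ha0, rfl⟩
  rw [alphaNorm] at h
  rwa [h, div_le_one ha] at h1

/-- The elementary tensor itself gives the upper bound; pairing with the rank one matrix of `u = 1`
gives the lower one. -/
theorem projNorm_one_kronecker_vecMulVec {n : ℕ} (y : Fin n → ℂ) :
    projNorm ((1 : Mat n) ⊗ₖ Matrix.vecMulVec y (star y)) = (star y ⬝ᵥ y).re := by
  refine le_antisymm ?_ ?_
  rotate_left
  · have h := norm_trace_ketBra_mul_le_projNorm (u := (1 : Mat n)) (by simp)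
      ((1 : Mat n) ⊗ₖ Matrix.vecMulVec y (star y))
    rw [trace_ketBra_mul_kronecker] at h
    refine le_trans ?_ h
    simp only [Matrix.conjTranspose_one, mul_one, Matrix.transpose_one, one_mul,
      Matrix.trace_vecMulVec]
    rw [dotProduct_comm]
    exact Complex.re_le_norm _
  · refine (projNorm_kronecker_le _ _).trans ?_
    rw [traceNorm_eq_trace_of_posSemidef (Matrix.posSemidef_vecMulVec_self_star y),
      Matrix.trace_vecMulVec, dotProduct_comm]
    refine mul_le_of_le_one_left ?_ opNorm_one_le
    rw [star_dotProduct_self_eq_norm_sq, Complex.ofReal_re]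
    positivity

/-! ### Blocks of a Choi matrix and the Hilbert–Schmidt bound -/

/-- The block `(j, l) ↦ ρ (i, j) (k, l)`, which is the value of the map with Choi matrix `ρ` at the
matrix unit `E i k`. -/
def choiBlock {n : ℕ} (ρ : Mat2 n) (i k : Fin n) : Mat n := fun j l => ρ (i, j) (k, l)

theorem conjTranspose_choiBlock {n : ℕ} {ρ : Mat2 n} (h : ρ.IsHermitian) (i k : Fin n) :
    (choiBlock ρ i k)ᴴ = choiBlock ρ k i := by
  ext j l
  exact h.apply (k, j) (i, l)

theorem trace_mul_one_kronecker {n : ℕ} (ρ : Mat2 n) (y : Fin n → ℂ) :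
    Matrix.trace (ρ * (1 : Mat n) ⊗ₖ Matrix.vecMulVec y (star y)) =
      star y ⬝ᵥ ((∑ i, choiBlock ρ i i) *ᵥ y) := by
  have : Matrix.trace (ρ * (1 : Mat n) ⊗ₖ Matrix.vecMulVec y (star y)) =
      Matrix.trace ((∑ i, choiBlock ρ i i) * Matrix.vecMulVec y (star y)) := by
    simp only [Finset.sum_mul, Matrix.trace_sum]
    simp only [Matrix.trace, Matrix.diag_apply, Matrix.mul_apply, Matrix.kronecker_apply,
      Fintype.sum_prod_type, choiBlock]
    refine Finset.sum_congr rfl fun i _ => Finset.sum_congr rfl fun j _ => ?_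
    rw [Finset.sum_eq_single i]
    · simp
    · intro k _ hk
      simp [Matrix.one_apply_ne hk]
    · simp
  rw [this, Matrix.mul_vecMulVec, Matrix.trace_vecMulVec, dotProduct_comm]

theorem posSemidef_one_sub_sum_choiBlock {n : ℕ} {ρ : Mat2 n} (hρ : ρ ∈ choiSet n) :
    (1 - ∑ i, choiBlock ρ i i).PosSemidef := by
  obtain ⟨hH, hα, -, -⟩ := hρ
  have hherm : (1 - ∑ i, choiBlock ρ i i).IsHermitian := by
    refine Matrix.isHermitian_one.sub ?_
    rw [Matrix.IsHermitian, Matrix.conjTranspose_sum]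
    exact Finset.sum_congr rfl fun i _ => conjTranspose_choiBlock hH i i
  refine .of_dotProduct_mulVec_nonneg hherm fun y => ?_
  rcases eq_or_ne y 0 with rfl | hy
  · simp
  have hypos : 0 < (star y ⬝ᵥ y).re := by
    rw [star_dotProduct_self_eq_norm_sq, Complex.ofReal_re]
    have : WithLp.toLp 2 y ≠ 0 := by simpa using hy
    positivity
  have h1 := projNorm_one_kronecker_vecMulVec y
  have hne : (1 : Mat n) ⊗ₖ Matrix.vecMulVec y (star y) ≠ 0 := by
    intro h0
    have h3 := projNorm_kronecker_le (0 : Mat n) (0 : Mat n)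
    rw [h0] at h1
    have : projNorm (0 : Mat2 n) ≤ 0 := by simpa [opNorm] using h3
    linarith
  have h3 := norm_trace_mul_le_projNorm_of_alphaNorm_eq_one hα (h1 ▸ hypos) hne
  rw [trace_mul_one_kronecker] at h3
  have h4 := (Complex.re_le_norm _).trans (h3.trans_eq h1)
  have him : (star y ⬝ᵥ ((1 - ∑ i, choiBlock ρ i i) *ᵥ y)).im = 0 :=
    hherm.im_star_dotProduct_mulVec_self y
  refine Complex.nonneg_iff.2 ⟨?_, him.symm⟩
  rw [Matrix.sub_mulVec, Matrix.one_mulVec, dotProduct_sub, Complex.sub_re]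
  linarith

theorem star_tensorVec_single_dotProduct_mulVec {n : ℕ} (ρ : Mat2 n) (i k : Fin n)
    (y : Fin n → ℂ) :
    star (tensorVec (Pi.single i 1) y) ⬝ᵥ (ρ *ᵥ tensorVec (Pi.single k 1) y) =
      star y ⬝ᵥ (choiBlock ρ i k *ᵥ y) := by
  have h : ∀ (f : Fin n → Fin n → ℂ) (k : Fin n),
      ∑ i, ∑ j, (Pi.single k (1 : ℂ) : Fin n → ℂ) i * f i j = ∑ j, f k j := fun f k => by
    rw [Finset.sum_eq_single k]
    · simp
    · intro i _ hi; simp [Pi.single_eq_of_ne hi]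
    · simp
  have hs : ∀ i l : Fin n, star ((Pi.single i (1 : ℂ) : Fin n → ℂ) l) =
      (Pi.single i (1 : ℂ) : Fin n → ℂ) l := fun i l => by
    by_cases h : l = i
    · subst h; simp
    · simp [h]
  simp only [dotProduct, Matrix.mulVec, tensorVec, choiBlock, Pi.star_apply,
    Fintype.sum_prod_type, star_mul', hs]
  simp only [mul_assoc, h]
  refine Finset.sum_congr rfl fun j _ => ?_
  congr 1
  simp only [mul_left_comm (ρ _ _), h]

/-- Block positivity at `(e_i + c e_k) ⊗ y` with `|c| = 1`. -/
theorem posSemidef_choiBlock_combination {n : ℕ} {ρ : Mat2 n} (hH : ρ.IsHermitian)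
    (hρ : IsBlockPositive ρ) (i k : Fin n) (c : ℂ) (hc : star c * c = 1) :
    (choiBlock ρ i i + choiBlock ρ k k +
      (c • choiBlock ρ i k + star c • choiBlock ρ k i)).PosSemidef := by
  refine .of_dotProduct_mulVec_nonneg ?_ fun y => ?_
  · rw [Matrix.IsHermitian]
    simp only [Matrix.conjTranspose_add, Matrix.conjTranspose_smul, conjTranspose_choiBlock hH,
      star_star]
    rw [add_comm (star c • _)]
  · have h := hρ (Pi.single i 1 + c • Pi.single k 1) y
    have e : tensorVec (Pi.single i 1 + c • Pi.single k 1) y =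
        tensorVec (Pi.single i 1) y + c • tensorVec (Pi.single k 1) y := by
      ext p
      simp only [tensorVec, Pi.add_apply, Pi.smul_apply, smul_eq_mul]
      ring
    rw [e] at h
    simp only [star_add, star_smul, Matrix.mulVec_add, Matrix.mulVec_smul, add_dotProduct,
      dotProduct_add, smul_dotProduct, dotProduct_smul, star_tensorVec_single_dotProduct_mulVec,
      smul_eq_mul] at h
    simp only [Matrix.add_mulVec, Matrix.smul_mulVec, dotProduct_add, dotProduct_smul, smul_eq_mul]
    refine h.trans_eq ?_
    linear_combination (star y ⬝ᵥ (choiBlock ρ k k *ᵥ y)) * hc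

theorem posSemidef_choiBlock_self {n : ℕ} {ρ : Mat2 n} (hH : ρ.IsHermitian)
    (hρ : IsBlockPositive ρ) (i : Fin n) : (choiBlock ρ i i).PosSemidef := by
  refine .of_dotProduct_mulVec_nonneg (conjTranspose_choiBlock hH i i) fun y => ?_
  rw [← star_tensorVec_single_dotProduct_mulVec]
  exact hρ _ _

theorem trace_mul_re_nonneg {n : ℕ} {a b : Mat n} (ha : a.PosSemidef) (hb : b.PosSemidef) :
    0 ≤ (Matrix.trace (a * b)).re := by
  have h : CFC.sqrt a * CFC.sqrt a = a :=
    CFC.sqrt_mul_sqrt_self a (Matrix.nonneg_iff_posSemidef.2 ha)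
  have hs : (CFC.sqrt a).PosSemidef := Matrix.nonneg_iff_posSemidef.1 (CFC.sqrt_nonneg a)
  have := (hb.mul_mul_conjTranspose_same (CFC.sqrt a)).trace_nonneg
  rw [hs.1.eq, Matrix.trace_mul_comm, ← mul_assoc, h] at this
  exact (Complex.nonneg_iff.1 this).1

theorem trace_mul_self_re_le {n : ℕ} {a : Mat n} (ha : a.PosSemidef) (h1 : (1 - a).PosSemidef) :
    (Matrix.trace (a * a)).re ≤ (Matrix.trace a).re := by
  have := trace_mul_re_nonneg ha h1
  rw [mul_sub, mul_one, Matrix.trace_sub, Complex.sub_re] at this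
  linarith

/-- The product `(d + y)(d - y)` of positive matrices has nonnegative trace, and its cross terms
cancel under the trace. -/
theorem trace_mul_self_re_le_of_posSemidef_add_sub {n : ℕ} {d y : Mat n} (hp : (d + y).PosSemidef)
    (hm : (d - y).PosSemidef) : (Matrix.trace (y * y)).re ≤ (Matrix.trace (d * d)).re := by
  have h := trace_mul_re_nonneg hp hm
  have e : Matrix.trace ((d + y) * (d - y)) = Matrix.trace (d * d) - Matrix.trace (y * y) := by
    rw [add_mul, mul_sub, mul_sub]
    simp only [Matrix.trace_add, Matrix.trace_sub]
    rw [Matrix.trace_mul_comm d y]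
    ring
  rw [e, Complex.sub_re] at h
  linarith

theorem trace_choiBlock_mul_re_le {n : ℕ} {ρ : Mat2 n} (hρ : ρ ∈ choiSet n) (i k : Fin n) :
    (Matrix.trace (choiBlock ρ i k * choiBlock ρ k i)).re ≤
      ((Matrix.trace (choiBlock ρ i i)).re + (Matrix.trace (choiBlock ρ k k)).re) / 2 := by
  have h1 := posSemidef_one_sub_sum_choiBlock hρ
  obtain ⟨hH, -, hB, -⟩ := hρ
  have hpos := posSemidef_choiBlock_self hH hB
  rcases eq_or_ne i k with rfl | hik
  · have : (1 - choiBlock ρ i i).PosSemidef := by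
      have := h1.add (Matrix.posSemidef_sum (Finset.univ.erase i) fun j _ => hpos j)
      rw [← Finset.add_sum_erase _ _ (Finset.mem_univ i)] at this
      convert this using 1
      abel
    have := trace_mul_self_re_le (hpos i) this
    linarith
  have hD : (1 - (choiBlock ρ i i + choiBlock ρ k k)).PosSemidef := by
    have := h1.add (Matrix.posSemidef_sum ((Finset.univ.erase i).erase k) fun j _ => hpos j)
    rw [← Finset.add_sum_erase _ _ (Finset.mem_univ i),
      ← Finset.add_sum_erase (Finset.univ.erase i) _ (Finset.mem_erase.2 ⟨hik.symm, Finset.mem_univ k⟩)]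
      at this
    convert this using 1
    abel
  have hDD := trace_mul_self_re_le ((hpos i).add (hpos k)) hD
  have key : ∀ c : ℂ, star c * c = 1 →
      (Matrix.trace ((c • choiBlock ρ i k + star c • choiBlock ρ k i) *
        (c • choiBlock ρ i k + star c • choiBlock ρ k i))).re ≤
      (Matrix.trace (choiBlock ρ i i + choiBlock ρ k k)).re := fun c hc => by
    refine (trace_mul_self_re_le_of_posSemidef_add_sub
      (posSemidef_choiBlock_combination hH hB i k c hc) ?_).trans hDD
    have := posSemidef_choiBlock_combination hH hB i k (-c) (by simpa using hc)
    convert this using 1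
    rw [star_neg, neg_smul, neg_smul]
    abel
  -- Adding the cases `c = 1` and `c = I` cancels the traces of `(A i k)²` and `(A k i)²`, leaving
  -- four copies of the mixed trace.
  have ha := key 1 (by simp)
  have hb := key Complex.I (by simp)
  simp only [star_one, one_smul, Complex.star_def, Complex.conj_I, add_mul, mul_add,
    Matrix.smul_mul, Matrix.mul_smul, Matrix.trace_add, Matrix.trace_smul, smul_smul, neg_mul,
    mul_neg, Complex.I_mul_I, Complex.add_re, neg_neg, smul_eq_mul, Complex.neg_re,
    Matrix.trace_mul_comm (choiBlock ρ k i) (choiBlock ρ i k), one_mul] at ha hb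
  linarith

/-- The Choi matrices of normalized unital positive maps have Hilbert–Schmidt norm at most `n`. -/
theorem trace_mul_self_re_le_of_mem_choiSet {n : ℕ} {ρ : Mat2 n} (hρ : ρ ∈ choiSet n) :
    (Matrix.trace (ρ * ρ)).re ≤ (n : ℝ) ^ 2 := by
  have e : Matrix.trace (ρ * ρ) =
      ∑ i, ∑ k, Matrix.trace (choiBlock ρ i k * choiBlock ρ k i) := by
    simp only [Matrix.trace, Matrix.diag_apply, Matrix.mul_apply, Fintype.sum_prod_type, choiBlock]
    exact Finset.sum_congr rfl fun i _ => Finset.sum_comm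
  have ht : ∑ i, (Matrix.trace (choiBlock ρ i i)).re = n := by
    have h := congrArg Complex.re hρ.2.2.2
    simp only [Matrix.trace, Matrix.diag_apply, Fintype.sum_prod_type, Complex.re_sum,
      Complex.natCast_re] at h
    simpa [Matrix.trace, choiBlock] using h
  rw [e]
  simp only [Complex.re_sum]
  refine (Finset.sum_le_sum fun i _ => Finset.sum_le_sum fun k _ =>
    trace_choiBlock_mul_re_le hρ i k).trans_eq ?_
  simp only [← Finset.sum_div, Finset.sum_add_distrib, ht, Finset.sum_const, Finset.card_univ,
    Fintype.card_fin, nsmul_eq_mul, ← Finset.mul_sum]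
  ring

/-! ### Exposed points from maximal Hilbert–Schmidt norm -/

/-- The functional `σ ↦ Re Tr (ρ σ)`. -/
noncomputable def reTraceMul {n : ℕ} (ρ : Mat2 n) : StrongDual ℝ (Mat2 n) where
  toFun σ := (Matrix.trace (ρ * σ)).re
  map_add' σ τ := by rw [mul_add, Matrix.trace_add, Complex.add_re]
  map_smul' c σ := by simp
  cont := Complex.continuous_re.comp (by fun_prop)

/-- Both `σ` and `ρ` lie in the ball, so `‖σ - ρ‖² ≤ 2n² - 2 Re Tr (ρ σ)`: the functional is at most
`n²`, with equality only at `ρ`. -/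
theorem mem_exposedPoints_choiSet {n : ℕ} {ρ : Mat2 n} (hρ : ρ ∈ choiSet n)
    (h : Matrix.trace (ρ * ρ) = (n : ℂ) ^ 2) : ρ ∈ (choiSet n).exposedPoints ℝ := by
  have hre : (Matrix.trace (ρ * ρ)).re = (n : ℝ) ^ 2 := by
    rw [h, ← Complex.ofReal_natCast, ← Complex.ofReal_pow, Complex.ofReal_re]
  have key : ∀ σ ∈ choiSet n, 0 ≤ (Matrix.trace ((σ - ρ)ᴴ * (σ - ρ))).re ∧
      (Matrix.trace ((σ - ρ)ᴴ * (σ - ρ))).re ≤ 2 * (n : ℝ) ^ 2 - 2 * reTraceMul ρ σ := by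
    intro σ hσ
    refine ⟨(Complex.nonneg_iff.1
      (Matrix.posSemidef_conjTranspose_mul_self (σ - ρ)).trace_nonneg).1, ?_⟩
    have hs := trace_mul_self_re_le_of_mem_choiSet hσ
    have e : (Matrix.trace ((σ - ρ)ᴴ * (σ - ρ))).re = (Matrix.trace (σ * σ)).re
        + (Matrix.trace (ρ * ρ)).re - 2 * reTraceMul ρ σ := by
      change _ = _ - 2 * (Matrix.trace (ρ * σ)).re
      rw [Matrix.conjTranspose_sub, hσ.1.eq, hρ.1.eq, sub_mul, mul_sub, mul_sub]
      simp only [Matrix.trace_sub, Complex.sub_re]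
      rw [Matrix.trace_mul_comm σ ρ]
      ring
    rw [e, hre]
    linarith
  have hρρ : reTraceMul ρ ρ = (n : ℝ) ^ 2 := hre
  refine ⟨hρ, reTraceMul ρ, fun σ hσ => ⟨?_, fun hle => ?_⟩⟩
  · obtain ⟨h1, h2⟩ := key σ hσ
    linarith
  · obtain ⟨h1, h2⟩ := key σ hσ
    have h0 : (Matrix.trace ((σ - ρ)ᴴ * (σ - ρ))).re = 0 := by linarith
    have him := (Complex.nonneg_iff.1
      (Matrix.posSemidef_conjTranspose_mul_self (σ - ρ)).trace_nonneg).2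
    exact sub_eq_zero.1 (Matrix.trace_conjTranspose_mul_self_eq_zero_iff.1
      (Complex.ext h0 him.symm))

/-! ### Maximally entangled vectors as unitaries -/

theorem trace_ketBra_of_unitary {n : ℕ} {u : Mat n} (hu : uᴴ * u = 1) :
    Matrix.trace (ketBra (fun p => u p.1 p.2)) = n := by
  have h := trace_ketBra_mul_kronecker u 1 1
  rwa [Matrix.one_kronecker_one, mul_one, mul_one, mul_one, hu, Matrix.transpose_one,
    Matrix.trace_one, Fintype.card_fin] at h

theorem trace_ketBra_mul_ketBra_of_unitary {n : ℕ} {u : Mat n} (hu : uᴴ * u = 1) :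
    Matrix.trace (ketBra (fun p => u p.1 p.2) * ketBra (fun p => u p.1 p.2)) = (n : ℂ) ^ 2 := by
  have h := trace_ketBra_of_unitary hu
  rw [ketBra, Matrix.trace_vecMulVec] at h
  rw [ketBra, Matrix.vecMulVec_mul_vecMulVec, Matrix.trace_vecMulVec, dotProduct_smul, h,
    dotProduct_comm, h, smul_eq_mul, sq]

theorem ketBra_mem_choiSet_of_unitary {n : ℕ} [NeZero n] {u : Mat n} (hu : uᴴ * u = 1) :
    ketBra (fun p => u p.1 p.2) ∈ choiSet n := by
  have hpsd : (ketBra fun p => u p.1 p.2).PosSemidef := Matrix.posSemidef_vecMulVec_self_star _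
  refine ⟨hpsd.1, ?_, fun x y => hpsd.dotProduct_mulVec_nonneg _, trace_ketBra_of_unitary hu⟩
  have hn : (0 : ℝ) < n := Nat.cast_pos.2 (NeZero.pos n)
  have hle : ∀ r ∈ {r : ℝ | ∃ a : Mat2 n, a ≠ 0 ∧
      r = ‖Matrix.trace (ketBra (fun p => u p.1 p.2) * a)‖ / projNorm a}, r ≤ 1 := by
    rintro _ ⟨a, -, rfl⟩
    exact div_le_one_of_le₀ (norm_trace_ketBra_mul_le_projNorm hu a) (projNorm_nonneg a)
  have htr : ‖Matrix.trace (ketBra (fun p => u p.1 p.2) * (1 : Mat2 n))‖ = n := by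
    rw [mul_one, trace_ketBra_of_unitary hu, Complex.norm_natCast]
  have hproj : projNorm (1 : Mat2 n) = n := by
    refine le_antisymm ?_ (htr ▸ norm_trace_ketBra_mul_le_projNorm hu 1)
    have h := projNorm_kronecker_le (1 : Mat n) (1 : Mat n)
    rw [Matrix.one_kronecker_one, traceNorm_eq_trace_of_posSemidef Matrix.PosSemidef.one,
      Matrix.trace_one, Fintype.card_fin, Complex.natCast_re] at h
    exact h.trans (mul_le_of_le_one_left hn.le opNorm_one_le)
  -- The supremum is attained at the identity, whose pairing and projective norm both equal `n`.
  have hmem : (1 : ℝ) ∈ {r : ℝ | ∃ a : Mat2 n, a ≠ 0 ∧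
      r = ‖Matrix.trace (ketBra (fun p => u p.1 p.2) * a)‖ / projNorm a} :=
    ⟨1, one_ne_zero, by rw [htr, hproj, div_self hn.ne']⟩
  exact le_antisymm (csSup_le ⟨1, hmem⟩ hle) (le_csSup ⟨1, hle⟩ hmem)

theorem IsMaximallyEntangled.exists_unitary {n : ℕ} [NeZero n] {x : Fin n × Fin n → ℂ}
    (hx : IsMaximallyEntangled x) :
    ∃ u : Mat n, uᴴ * u = 1 ∧ (n : ℂ) • ketBra x = ketBra (fun p => u p.1 p.2) := by
  obtain ⟨f, g, rfl⟩ := hx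
  -- The basis vectors are the columns of `F` and the rows of `G`, so `∑ fₖ ⊗ gₖ` reshapes to `F *
  -- G`.
  let F : Mat n := Matrix.of fun i k => f k i
  let G : Mat n := Matrix.of fun k j => g k j
  have hF : Fᴴ * F = 1 := by
    ext k l
    have h := orthonormal_iff_ite.1 f.orthonormal k l
    rw [EuclideanSpace.inner_eq_star_dotProduct, dotProduct_comm] at h
    rw [Matrix.one_apply, ← h]
    rfl
  have hG : G * Gᴴ = 1 := by
    ext k l
    have h := orthonormal_iff_ite.1 g.orthonormal l k
    rw [EuclideanSpace.inner_eq_star_dotProduct] at h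
    simp only [Matrix.one_apply, eq_comm (a := k), ← h]
    rfl
  have hG' : Gᴴ * G = 1 := mul_eq_one_comm.1 hG
  refine ⟨F * G, ?_, ?_⟩
  · rw [Matrix.conjTranspose_mul, mul_assoc, ← mul_assoc Fᴴ, hF, one_mul, hG']
  · have hu : (∑ k, tensorVec (fun i => f k i) (fun j => g k j)) =
        fun p : Fin n × Fin n => (F * G) p.1 p.2 := by
      ext p
      rw [Finset.sum_apply]
      rfl
    have hc : (n : ℂ) * (((1 / Real.sqrt n : ℝ) : ℂ) * ((1 / Real.sqrt n : ℝ) : ℂ)) = 1 := by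
      rw [← Complex.ofReal_mul, div_mul_div_comm, Real.mul_self_sqrt n.cast_nonneg]
      have := NeZero.ne (n : ℂ)
      push_cast
      field_simp
    rw [hu, ketBra, ketBra, star_smul, Matrix.smul_vecMulVec, Matrix.vecMulVec_smul, smul_smul,
      smul_smul, Complex.star_def, Complex.conj_ofReal, mul_assoc, hc, one_smul]

theorem mainTheorem4 :
    (∀ s : Mat2 3, s ∈ choiSet 3 → IsSymmetry s → s ∈ (choiSet 3).exposedPoints ℝ) ∧
    (∀ x : Fin 3 × Fin 3 → ℂ, IsMaximallyEntangled x →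
      (3 : ℂ) • ketBra x ∈ (choiSet 3).exposedPoints ℝ) := by
  refine ⟨fun s hs h => mem_exposedPoints_choiSet hs ?_, fun x hx => ?_⟩
  · rw [h.2, Matrix.trace_one, Fintype.card_prod, Fintype.card_fin]
    norm_num
  · obtain ⟨u, hu, hxu⟩ := hx.exists_unitary
    have hxu' : (3 : ℂ) • ketBra x = ketBra (fun p => u p.1 p.2) := by exact_mod_cast hxu
    rw [hxu']
    exact mem_exposedPoints_choiSet (ketBra_mem_choiSet_of_unitary hu)
      (trace_ketBra_mul_ketBra_of_unitary hu)
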